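/- Let $\alpha\in(0,1)$, $T>0$, $\lambda\ge 0$, and let $\Omega\subset\mathbb R^d$, $d\in\{1,2,3\}$, be a bounded Lipschitz domain; $\langle\cdot,\cdot\rangle$ and $\|\cdot\|$ are the inner product and norm of $L_2(\Omega)$, and also $\langle\cdot,\cdot\rangle$ is the duality pairing of functionals on $H^1_0(\Omega)$ with functions in $H^1_0(\Omega)$. Let $\mathcal L$ be a linear (second-order elliptic) operator mapping $H_0^1(\Omega)$ to functionals on $H_0^1(\Omega)$, with $\langle\mathcal Lv,v\rangle\ge\lambda\|v\|^2$ for all $v\in H^1_0(\Omega)$. Let $D_t^\alpha$ be the Caputo derivative in time, $$D_t^\alpha v(t)=\frac1{\Gamma(1-\alpha)}\int_0^t(t-s)^{-\alpha}\,\partial_sv(s)\,ds ,$$ where $\partial_s v$ is taken in the sense of distributions (a jump of $v$ at $0$ contributes a Dirac mass) and the integral is improper at $0$, that is, $$D_t^\alpha v(t)=\frac1{\Gamma(1-\alpha)}\lim_{\epsilon\to0^+}\Bigl\{t^{-\alpha}[v(\epsilon)-v(0)]+\int_\epsilon^t(t-s)^{-\alpha}\,\partial_sv(s)\,ds\Bigr\}.$$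 Let $u$ and $u_h$ be in $L_\infty(0,t;L_2(\Omega))\cap W^{1,\infty}(\epsilon,t;L_2(\Omega))$ for any $0<\epsilon<t\le T$, with $u(\cdot,t),u_h(\cdot,t)\in H^1_0(\Omega)$ for $0<t\le T$ and $u(\cdot,0)=u_h(\cdot,0)=u_0\in L_2(\Omega)$. Suppose that $D_t^\alpha u+\mathcal Lu=f$ for $0<t\le T$, and that the residual $R_h(\cdot,t)=(D_t^\alpha+\mathcal L)u_h(\cdot,t)-f(\cdot,t)$ is in $L_2(\Omega)$ for $0<t\le T$. Set $e=u_h-u$, $\beta=1-\alpha$ and, for a parameter $\tau>0$ and $s,t>0$, $$\mathcal R_0(t)=\frac{t^{-\alpha}}{\Gamma(1-\alpha)}+\lambda,\qquad \mathcal E_1(t)=\max\{\tau,t\}^{\alpha-1},\qquad \rho(s)=s^{-\beta}\bigl[1-(\max\{0,1-s\})^\beta\bigr],\qquad \mathcal R_1(t)=\frac{t^{-1}\rho(\tau/t)}{\Gamma(1-\alpha)}+\lambda\,\mathcal E_1(t).$$ Then for every $\tau>0$ and $0<t\le T$ one has (with suprema in $[0,\infty]$) $$\|e(\cdot,t)\|\le\sup_{0<s\le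 t}\frac{\|R_h(\cdot,s)\|}{\mathcal R_0(s)},\qquad \|e(\cdot,t)\|\le t^{\alpha-1}\sup_{0<s\le t}\frac{\|R_h(\cdot,s)\|}{\mathcal R_1(s)},\qquad \|e(\cdot,t)\|\le \mathcal E_1(t)\sup_{0<s\le t}\frac{\|R_h(\cdot,s)\|}{\mathcal R_1(s)}.$$ Moreover, $\rho(s)\ge s^{-\beta}\min\{\beta s,1\}$ for all $s>0$. -/

import Mathlib

open MeasureTheory Set Filter Topology
open scoped ENNReal ContDiff

noncomputable section

namespace FracParabolic

/-- The Hilbert space `L₂(Ω)` of real-valued functions, for `Ω ⊆ ℝ^d`. -/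
abbrev L2 {d : ℕ} (Ω : Set (EuclideanSpace ℝ (Fin d))) : Type :=
  Lp ℝ 2 (volume.restrict Ω)

/-- The pairs `(φ, ∇φ)`, as elements of `L₂(Ω) × L₂(Ω)^d`, with `φ ∈ C_c^∞(Ω)`. -/
def testGraph {d : ℕ} (Ω : Set (EuclideanSpace ℝ (Fin d))) :
    Submodule ℝ (L2 Ω × (Fin d → L2 Ω)) where
  carrier := {p | ∃ φ : EuclideanSpace ℝ (Fin d) → ℝ,
    ContDiff ℝ ∞ φ ∧ HasCompactSupport φ ∧ tsupport φ ⊆ Ω ∧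
    (p.1 =ᵐ[volume.restrict Ω] φ) ∧
    ∀ i, p.2 i =ᵐ[volume.restrict Ω] fun x => fderiv ℝ φ x (EuclideanSpace.single i 1)}
  zero_mem' := by
    refine ⟨fun _ => 0, contDiff_const, HasCompactSupport.zero, ?_, Lp.coeFn_zero _ _ _, ?_⟩
    · have h : tsupport (fun _ : EuclideanSpace ℝ (Fin d) => (0 : ℝ)) = ∅ :=
        tsupport_eq_empty_iff.2 rfl
      rw [h]
      exact empty_subset _
    · intro i
      filter_upwards [Lp.coeFn_zero ℝ 2 (volume.restrict Ω)] with x hx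
      simpa using hx
  add_mem' := by
    rintro p q ⟨φ, h1, h2, h3, h4, h5⟩ ⟨ψ, k1, k2, k3, k4, k5⟩
    refine ⟨φ + ψ, h1.add k1, h2.add k2,
      (tsupport_add φ ψ).trans (union_subset h3 k3), ?_, ?_⟩
    · filter_upwards [h4, k4, Lp.coeFn_add p.1 q.1] with x a b c
      rw [Prod.fst_add, c, Pi.add_apply, Pi.add_apply, a, b]
    · intro i
      filter_upwards [h5 i, k5 i, Lp.coeFn_add (p.2 i) (q.2 i)] with x a b c
      rw [Prod.snd_add, Pi.add_apply, c, Pi.add_apply, a, b,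
        fderiv_add (h1.differentiable (by simp) x) (k1.differentiable (by simp) x)]
      rfl
  smul_mem' := by
    rintro c p ⟨φ, h1, h2, h3, h4, h5⟩
    refine ⟨c • φ, h1.const_smul c, h2.mono (Function.support_const_smul_subset c φ),
      (closure_mono (Function.support_const_smul_subset c φ)).trans h3, ?_, ?_⟩
    · filter_upwards [h4, Lp.coeFn_smul c p.1] with x a b
      rw [Prod.smul_fst, b, Pi.smul_apply, Pi.smul_apply, a]
    · intro i
      filter_upwards [h5 i, Lp.coeFn_smul c (p.2 i)] with x a b
      rw [Prod.smul_snd, Pi.smul_apply, b, Pi.smul_apply, a,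
        fderiv_const_smul (h1.differentiable (by simp) x)]
      rfl

/-- `H¹₀(Ω)`, as a subspace of `L₂(Ω)`: the closure of `C_c^∞(Ω)` in the `H¹` norm, that is, the
first components of the limits of pairs `(φₙ, ∇φₙ)` in `L₂(Ω) × L₂(Ω)^d`. -/
def H10 {d : ℕ} (Ω : Set (EuclideanSpace ℝ (Fin d))) : Submodule ℝ (L2 Ω) :=
  (testGraph Ω).topologicalClosure.map (LinearMap.fst ℝ (L2 Ω) (Fin d → L2 Ω))

section Time

variable {H : Type*} [NormedAddCommGroup H] [NormedSpace ℝ H]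

/-- `v ∈ W^{1,∞}(a,b;H)` (the continuous representative on `[a,b]`): `v` and `∂ₜ v` are essentially
bounded and `v` is the integral of `∂ₜ v`. Such a `v` is differentiable almost everywhere, and its
weak derivative `∂ₜ v` is the almost everywhere derivative `deriv v`. -/
def MemW1Inf (a b : ℝ) (v : ℝ → H) : Prop :=
  MemLp v ∞ (volume.restrict (Ioo a b)) ∧
  MemLp (deriv v) ∞ (volume.restrict (Ioo a b)) ∧
  ∀ s ∈ Icc a b, ∀ t ∈ Icc a b, v t - v s = ∫ r in s..t, deriv v r

/-- `v ∈ L_∞(0,t;H) ∩ W^{1,∞}(ε,t;H)` for any `0 < ε < t ≤ T`. Nothing is assumed on the behaviour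
of `v` at `0`, apart from boundedness: `v` may be discontinuous there. -/
def TimeRegular (T : ℝ) (v : ℝ → H) : Prop :=
  ∀ ε t : ℝ, 0 < ε → ε < t → t ≤ T →
    MemLp v ∞ (volume.restrict (Ioo 0 t)) ∧ MemW1Inf ε t v

/-- The fractional integral `J_t^{1-α} w (t) = Γ(1-α)⁻¹ ∫₀ᵗ (t-s)^{-α} w(s) ds`. -/
def fracInt (α : ℝ) (w : ℝ → H) (t : ℝ) : H :=
  (Real.Gamma (1 - α))⁻¹ • ∫ s in (0 : ℝ)..t, (t - s) ^ (-α) • w s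

/-- The Caputo derivative `D_t^α v (t) = J_t^{1-α}(∂ₜ v)(t)` for `t > 0`, where `∂ₜ v` is understood
on `[0,t]` in the sense of distributions: a jump of `v` at `0` contributes a Dirac mass at `0`, and
the integral over `(0,t)` is improper at `0`. So
`D_t^α v (t) = Γ(1-α)⁻¹ lim_{ε → 0+} { t^{-α} (v(ε) - v(0)) + ∫_ε^t (t-s)^{-α} ∂ₛ v(s) ds }`.
For every `v` with `TimeRegular T v` and every `0 < t ≤ T` the limit exists (`H` complete,
`0 < α < 1`) and equals
`Γ(1-α)⁻¹ { t^{-α} (v(t) - v(0)) + ∫₀ᵗ α (t-s)^{-α-1} (v(t) - v(s)) ds }`.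
If `v` is continuous at `0` and `(t-s)^{-α} ∂ₛ v` is integrable, it is the ordinary
`J_t^{1-α}(∂ₜ v)(t)`: see `caputoDeriv_eq_fracInt`. -/
def caputoDeriv (α : ℝ) (v : ℝ → H) (t : ℝ) : H :=
  limUnder (𝓝[>] (0 : ℝ)) fun ε : ℝ =>
    (Real.Gamma (1 - α))⁻¹ •
      (t ^ (-α) • (v ε - v 0) + ∫ s in ε..t, (t - s) ^ (-α) • deriv v s)

/-- For functions that are continuous at `0` with integrable derivative, `caputoDeriv` is the
classical Caputo derivative `J_t^{1-α}(∂ₜ v)`. -/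
theorem caputoDeriv_eq_fracInt {α t : ℝ} {v : ℝ → H} (ht : 0 < t)
    (hv : ContinuousWithinAt v (Ioi 0) 0)
    (hint : IntervalIntegrable (fun s => (t - s) ^ (-α) • deriv v s) volume 0 t) :
    caputoDeriv α v t = fracInt α (deriv v) t := by
  refine Tendsto.limUnder_eq ?_
  unfold fracInt
  refine Tendsto.const_smul ?_ _
  have h1 : Tendsto (fun ε : ℝ => t ^ (-α) • (v ε - v 0)) (𝓝[>] 0) (𝓝 0) := by
    have := (hv.tendsto.sub_const (v 0)).const_smul (t ^ (-α))
    simpa using this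
  have h2 : Tendsto (fun ε : ℝ => ∫ s in ε..t, (t - s) ^ (-α) • deriv v s) (𝓝[>] 0)
      (𝓝 (∫ s in (0 : ℝ)..t, (t - s) ^ (-α) • deriv v s)) := by
    have hc := intervalIntegral.continuousOn_primitive_interval_left
      (a := (0 : ℝ)) (b := t) (μ := volume)
      (f := fun s => (t - s) ^ (-α) • deriv v s)
      (by
        rw [uIcc_of_le ht.le, integrableOn_Icc_iff_integrableOn_Ioc]
        exact (intervalIntegrable_iff_integrableOn_Ioc_of_le ht.le).1 hint)
    have h0 := (hc 0 left_mem_uIcc).tendsto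
    refine h0.mono_left ?_
    rw [uIcc_of_le ht.le, ← nhdsWithin_Ioc_eq_nhdsGT ht]
    exact nhdsWithin_mono _ Ioc_subset_Icc_self
  simpa using h1.add h2

end Time

/-- `ρ(s) = s^{-β} [1 - ((1-s)⁺)^β]` with `β = 1 - α`. -/
def rho (α s : ℝ) : ℝ :=
  s ^ (-(1 - α)) * (1 - (max 0 (1 - s)) ^ (1 - α))

/-- `𝓔₁(t) = max{τ, t}^{α-1}`. -/
def E1 (α τ t : ℝ) : ℝ := (max τ t) ^ (α - 1)

/-- `𝓡₀(t) = Γ(1-α)⁻¹ t^{-α} + λ`. -/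
def R0 (α lam t : ℝ) : ℝ := (Real.Gamma (1 - α))⁻¹ * t ^ (-α) + lam

/-- `𝓡₁(t) = Γ(1-α)⁻¹ t⁻¹ ρ(τ/t) + λ 𝓔₁(t)`. -/
def R1 (α lam τ t : ℝ) : ℝ :=
  (Real.Gamma (1 - α))⁻¹ * t⁻¹ * rho α (τ / t) + lam * E1 α τ t

end FracParabolic

end

/-!
Integrating by parts in the Caputo derivative gives Marchaud's form
`Γ(1-α)⁻¹ {t^{-α} (v(t) - v(0)) + α ∫₀ᵗ (t-s)^{-α-1} (v(t) - v(s)) ds}`, which is monotone: if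
`v ≤ w` on `(0,t)` with equality at `t`, then the derivative of `v` at `t` is at least that of `w`.
This gives a comparison principle for scalar functions, and, by Cauchy–Schwarz, the energy
inequality for `e` bounds `(D_t^α + λ) ‖e‖` by `‖R_h‖`. A multiple of `𝓔₁` is a barrier for `‖e‖`,
because the Marchaud derivative of `𝓔₁` is explicit: `(D_t^α + λ) 𝓔₁ = 𝓡₁`. The bound in terms of
`𝓡₀` is the case `τ = t`, where `𝓡₁(s) = t^{α-1} 𝓡₀(s)` for `s ≤ t`.
-/

namespace FracParabolic

section Marchaud

variable {E F : Type*} [NormedAddCommGroup E] [NormedSpace ℝ E] [NormedAddCommGroup F]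
  [NormedSpace ℝ F] {α t : ℝ} {v w : ℝ → E}

/-- The Riemann–Liouville derivative of order `α` of `v : (0,t] → E` at `t`, in Marchaud's form.
It involves neither the derivative of `v` nor the value `v 0`. -/
noncomputable def marchaudDeriv (α : ℝ) (v : ℝ → E) (t : ℝ) : E :=
  (Real.Gamma (1 - α))⁻¹ •
    (t ^ (-α) • v t + α • ∫ s in (0 : ℝ)..t, (t - s) ^ (-α - 1) • (v t - v s))

/-- Convergence of the integral in `marchaudDeriv α v t`. -/
def MarchaudIntegrable (α : ℝ) (v : ℝ → E) (t : ℝ) : Prop :=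
  IntervalIntegrable (fun s => (t - s) ^ (-α - 1) • (v t - v s)) volume 0 t

theorem MarchaudIntegrable.add (hv : MarchaudIntegrable α v t) (hw : MarchaudIntegrable α w t) :
    MarchaudIntegrable α (fun s => v s + w s) t := by
  refine (IntervalIntegrable.add hv hw).congr fun s _ => ?_
  simp only [← smul_add, add_sub_add_comm]

theorem MarchaudIntegrable.sub (hv : MarchaudIntegrable α v t) (hw : MarchaudIntegrable α w t) :
    MarchaudIntegrable α (fun s => v s - w s) t := by
  refine (IntervalIntegrable.sub hv hw).congr fun s _ => ?_
  simp only [← smul_sub, sub_sub_sub_comm]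

theorem MarchaudIntegrable.clm_apply (A : E →L[ℝ] F) (hv : MarchaudIntegrable α v t) :
    MarchaudIntegrable α (fun s => A (v s)) t := by
  refine (intervalIntegrable_iff.2 (A.integrable_comp (intervalIntegrable_iff.1 hv))).congr
    fun s _ => ?_
  simp only [map_smul, map_sub]

theorem MarchaudIntegrable.const_mul {f : ℝ → ℝ} (c : ℝ) (hf : MarchaudIntegrable α f t) :
    MarchaudIntegrable α (fun s => c * f s) t :=
  hf.clm_apply (ContinuousLinearMap.mul ℝ ℝ c)

theorem marchaudIntegrable_const (c : E) : MarchaudIntegrable α (fun _ => c) t := by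
  simp [MarchaudIntegrable]

theorem intervalIntegrable_kernel {a : ℝ} (hα1 : α < 1) :
    IntervalIntegrable (fun s : ℝ => (t - s) ^ (-α)) volume a t := by
  simpa using (intervalIntegral.intervalIntegrable_rpow' (a := t - a) (b := 0)
    (by linarith : -1 < -α)).comp_sub_left t

theorem marchaudIntegrable_of_norm_sub_le {C : ℝ} (hα1 : α < 1) (ht : 0 ≤ t)
    (hv : AEStronglyMeasurable v (volume.restrict (Ioc 0 t)))
    (hC : ∀ s ∈ Ioo 0 t, ‖v t - v s‖ ≤ C * (t - s)) : MarchaudIntegrable α v t := by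
  have hk := ((intervalIntegrable_kernel (t := t) (a := 0) hα1).const_mul C)
  rw [MarchaudIntegrable, intervalIntegrable_iff_integrableOn_Ioo_of_le ht]
  rw [intervalIntegrable_iff_integrableOn_Ioo_of_le ht] at hk
  rw [← restrict_Ioo_eq_restrict_Ioc] at hv
  have hm : Measurable fun s : ℝ => (t - s) ^ (-α - 1) := by fun_prop
  refine hk.mono' (hm.aestronglyMeasurable.smul (aestronglyMeasurable_const.sub hv)) ?_
  filter_upwards [ae_restrict_mem measurableSet_Ioo] with s hs
  have hts : 0 < t - s := sub_pos.2 hs.2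
  rw [norm_smul, Real.norm_of_nonneg (by positivity)]
  calc (t - s) ^ (-α - 1) * ‖v t - v s‖ ≤ (t - s) ^ (-α - 1) * (C * (t - s)) := by
        gcongr; exact hC s hs
    _ = C * (t - s) ^ (-α) := by
        rw [Real.rpow_sub_one hts.ne']
        field_simp

theorem MarchaudIntegrable.norm (ht : 0 ≤ t)
    (hm : AEStronglyMeasurable v (volume.restrict (Ioc 0 t))) (hv : MarchaudIntegrable α v t) :
    MarchaudIntegrable α (fun s => ‖v s‖) t := by
  rw [MarchaudIntegrable, intervalIntegrable_iff_integrableOn_Ioc_of_le ht] at *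
  have hk : Measurable fun s : ℝ => (t - s) ^ (-α - 1) := by fun_prop
  refine Integrable.mono hv (hk.aestronglyMeasurable.smul
    (aestronglyMeasurable_const.sub hm.norm)) (Eventually.of_forall fun s => ?_)
  rw [norm_smul, norm_smul]
  gcongr
  exact abs_norm_sub_norm_le _ _

theorem marchaudDeriv_const (c : E) :
    marchaudDeriv α (fun _ => c) t = (Real.Gamma (1 - α))⁻¹ • t ^ (-α) • c := by
  simp [marchaudDeriv]

theorem marchaudDeriv_add (hv : MarchaudIntegrable α v t) (hw : MarchaudIntegrable α w t) :
    marchaudDeriv α (fun s => v s + w s) t = marchaudDeriv α v t + marchaudDeriv α w t := by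
  have h := intervalIntegral.integral_add hv hw
  simp only [← smul_add, ← add_sub_add_comm] at h
  simp only [marchaudDeriv, h]
  module

theorem marchaudDeriv_sub (hv : MarchaudIntegrable α v t) (hw : MarchaudIntegrable α w t) :
    marchaudDeriv α (fun s => v s - w s) t = marchaudDeriv α v t - marchaudDeriv α w t := by
  have h := intervalIntegral.integral_sub hv hw
  simp only [← smul_sub, sub_sub_sub_comm (v t) _ (w t)] at h
  simp only [marchaudDeriv, h]
  module

theorem marchaudDeriv_clm_apply [CompleteSpace E] [CompleteSpace F] (A : E →L[ℝ] F)
    (hv : MarchaudIntegrable α v t) :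
    marchaudDeriv α (fun s => A (v s)) t = A (marchaudDeriv α v t) := by
  have h := A.intervalIntegral_comp_comm hv
  simp only [map_smul, map_sub] at h
  simp only [marchaudDeriv, h, map_smul, map_add]

theorem marchaudDeriv_const_mul {f : ℝ → ℝ} (c : ℝ) :
    marchaudDeriv α (fun s => c * f s) t = c * marchaudDeriv α f t := by
  simp only [marchaudDeriv, smul_eq_mul, ← mul_sub, mul_left_comm _ c,
    intervalIntegral.integral_const_mul]
  ring

end Marchaud

section Comparison

variable {α t T : ℝ} {f g : ℝ → ℝ}

theorem marchaudDeriv_le_of_touches (hα0 : 0 ≤ α) (hα1 : α < 1) (ht : 0 ≤ t)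
    (hf : MarchaudIntegrable α f t) (hg : MarchaudIntegrable α g t)
    (hle : ∀ s ∈ Ioo 0 t, f s ≤ g s) (heq : f t = g t) :
    marchaudDeriv α g t ≤ marchaudDeriv α f t := by
  have : 0 < Real.Gamma (1 - α) := Real.Gamma_pos_of_pos (by linarith)
  have hint := intervalIntegral.integral_mono_on_of_le_Ioo ht hg hf fun s hs => by
    have hts : 0 ≤ t - s := sub_nonneg.2 hs.2.le
    have hfg := hle s hs
    simp only [smul_eq_mul, heq]
    gcongr
  simp only [marchaudDeriv, smul_eq_mul, heq] at hint ⊢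
  gcongr

theorem le_of_marchaudDeriv_le {δ : ℝ} (hα0 : 0 ≤ α) (hα1 : α < 1) (hδ : 0 < δ)
    (hfc : ContinuousOn f (Ioc 0 T)) (hgc : ContinuousOn g (Ioc 0 T))
    (hf : ∀ t ∈ Ioc 0 T, MarchaudIntegrable α f t) (hg : ∀ t ∈ Ioc 0 T, MarchaudIntegrable α g t)
    (hinit : ∀ t ∈ Ioc 0 T, t ≤ δ → f t ≤ g t)
    (hD : ∀ t ∈ Ioc 0 T, g t < f t → marchaudDeriv α f t ≤ marchaudDeriv α g t) :
    ∀ t ∈ Ioc 0 T, f t ≤ g t := by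
  intro t₁ ht₁
  by_contra! hlt
  have hδt : δ < t₁ := not_le.1 fun h => hlt.not_ge (hinit t₁ ht₁ h)
  have hsub : Icc δ t₁ ⊆ Ioc 0 T := fun s hs => ⟨hδ.trans_le hs.1, hs.2.trans ht₁.2⟩
  obtain ⟨t, htm, hmax⟩ := isCompact_Icc.exists_isMaxOn ⟨t₁, hδt.le, le_rfl⟩
    ((hfc.sub hgc).mono hsub)
  have ht := hsub htm
  set c := f t - g t with hc
  have hc0 : 0 < c := (sub_pos.2 hlt).trans_le (hmax ⟨hδt.le, le_rfl⟩)
  have htouch : marchaudDeriv α (fun s => g s + c) t ≤ marchaudDeriv α f t := by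
    refine marchaudDeriv_le_of_touches hα0 hα1 ht.1.le (hf t ht)
      ((hg t ht).add (marchaudIntegrable_const c)) (fun s hs => ?_) (by simp [hc])
    rcases le_total s δ with hsδ | hsδ
    · linarith [hinit s ⟨hs.1, hs.2.le.trans ht.2⟩ hsδ]
    · linarith [show f s - g s ≤ c from hmax ⟨hsδ, hs.2.le.trans htm.2⟩]
  rw [marchaudDeriv_add (hg t ht) (marchaudIntegrable_const c), marchaudDeriv_const] at htouch
  have : 0 < Real.Gamma (1 - α) := Real.Gamma_pos_of_pos (by linarith)
  have hpos : 0 < (Real.Gamma (1 - α))⁻¹ • t ^ (-α) • c := by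
    have := Real.rpow_pos_of_pos ht.1 (-α)
    simp only [smul_eq_mul]; positivity
  linarith [hD t ht (sub_pos.1 hc0)]

-- The function `s ↦ ⟪e t, e s⟫` touches `s ↦ ‖e t‖ ‖e s‖` from below at `s = t`.
theorem norm_mul_marchaudDeriv_norm_le {H : Type*} [NormedAddCommGroup H] [InnerProductSpace ℝ H]
    [CompleteSpace H] {e : ℝ → H} (hα0 : 0 ≤ α) (hα1 : α < 1) (ht : 0 ≤ t)
    (he : MarchaudIntegrable α e t) (hn : MarchaudIntegrable α (fun s => ‖e s‖) t) :
    ‖e t‖ * marchaudDeriv α (fun s => ‖e s‖) t ≤ inner ℝ (e t) (marchaudDeriv α e t) := by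
  rw [← marchaudDeriv_const_mul, ← innerSL_apply_apply ℝ, ← marchaudDeriv_clm_apply _ he]
  refine marchaudDeriv_le_of_touches hα0 hα1 ht (he.clm_apply _)
    (hn.const_mul _) (fun s _ => real_inner_le_norm _ _) (real_inner_self_eq_norm_mul_norm _)

end Comparison

section Caputo

variable {E : Type*} [NormedAddCommGroup E] [NormedSpace ℝ E] {α t T : ℝ} {v : ℝ → E}

theorem setIntegral_Ioo_indicator_Iio {a b s : ℝ} (hs : s ∈ Ioo a b) (g : ℝ → E) :
    ∫ r in Ioo a b, (Iio s).indicator g r = ∫ r in a..s, g r := by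
  rw [setIntegral_indicator measurableSet_Iio, Ioo_inter_Iio, min_eq_right hs.2.le,
    ← integral_Ioc_eq_integral_Ioo, intervalIntegral.integral_of_le hs.1.le]

theorem setIntegral_Ioo_indicator_Ioi {a b r : ℝ} (hr : r ∈ Ioo a b) (g : ℝ → E) :
    ∫ s in Ioo a b, (Ioi r).indicator g s = ∫ s in r..b, g s := by
  rw [setIntegral_indicator measurableSet_Ioi, Ioo_inter_Ioi, max_eq_right hr.1.le,
    ← integral_Ioc_eq_integral_Ioo, intervalIntegral.integral_of_le hr.2.le]

theorem integral_primitive_smul [CompleteSpace E] {a b : ℝ} {κ : ℝ → ℝ} {q : ℝ → E} (hab : a ≤ b)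
    (hκm : AEStronglyMeasurable κ (volume.restrict (Ioo a b)))
    (hqm : AEStronglyMeasurable q (volume.restrict (Ioo a b)))
    (hκ : ∀ s ∈ Ioo a b, IntervalIntegrable κ volume a s)
    (hint : IntervalIntegrable (fun s => (∫ r in a..s, ‖κ r‖) • q s) volume a b) :
    ∫ s in a..b, (∫ r in a..s, κ r) • q s = ∫ r in a..b, κ r • ∫ s in r..b, q s := by
  set μ := volume.restrict (Ioo a b)
  let Φ : ℝ → ℝ → E := fun s => (Iio s).indicator fun r => κ r • q s
  have hΦm : AEStronglyMeasurable (Function.uncurry Φ) (μ.prod μ) :=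
    (hκm.comp_snd.smul hqm.comp_fst).indicator (measurableSet_lt measurable_snd measurable_fst)
  have hΦi : Integrable (Function.uncurry Φ) (μ.prod μ) := by
    refine (integrable_prod_iff hΦm).2 ⟨?_, ?_⟩
    · filter_upwards [ae_restrict_mem measurableSet_Ioo] with s hs
      have hκs := (intervalIntegrable_iff_integrableOn_Ioo_of_le hs.1.le).1 (hκ s hs)
      refine (integrable_indicator_iff measurableSet_Iio).2 (Integrable.smul_const ?_ (q s))
      rwa [Measure.restrict_restrict measurableSet_Iio, inter_comm, Ioo_inter_Iio,
        min_eq_right hs.2.le]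
    · refine ((intervalIntegrable_iff_integrableOn_Ioo_of_le hab).1 hint).norm.congr ?_
      filter_upwards [ae_restrict_mem measurableSet_Ioo] with s hs
      simp only [Function.uncurry, Φ, norm_indicator_eq_indicator_norm, norm_smul, μ]
      rw [setIntegral_Ioo_indicator_Iio hs, intervalIntegral.integral_mul_const,
        Real.norm_of_nonneg (intervalIntegral.integral_nonneg hs.1.le fun _ _ => norm_nonneg _)]
  have hinner : ∀ s ∈ Ioo a b, (∫ r in a..s, κ r) • q s = ∫ r, Φ s r ∂μ := fun s hs => by
    rw [setIntegral_Ioo_indicator_Iio hs, intervalIntegral.integral_smul_const]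
  have houter : ∀ r ∈ Ioo a b, ∫ s, Φ s r ∂μ = κ r • ∫ s in r..b, q s := fun r hr => by
    rw [← intervalIntegral.integral_smul]
    exact setIntegral_Ioo_indicator_Ioi hr _
  simp only [intervalIntegral.integral_of_le hab, integral_Ioc_eq_integral_Ioo]
  rw [setIntegral_congr_fun measurableSet_Ioo hinner, integral_integral_swap hΦi,
    setIntegral_congr_fun measurableSet_Ioo houter]

theorem hasDerivAt_kernel {s : ℝ} (hs : s < t) :
    HasDerivAt (fun s : ℝ => (t - s) ^ (-α)) (α * (t - s) ^ (-α - 1)) s := by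
  have h := ((hasDerivAt_id s).const_sub t).rpow_const (p := -α)
    (Or.inl (by simpa using (sub_pos.2 hs).ne'))
  exact h.congr_deriv (by simp)

theorem intervalIntegrable_kernel_deriv {a s : ℝ} (has : a ≤ s) (hst : s < t) :
    IntervalIntegrable (fun r : ℝ => (t - r) ^ (-α - 1)) volume a s := by
  refine ContinuousOn.intervalIntegrable_of_Icc has (ContinuousOn.rpow_const (by fun_prop) ?_)
  exact fun r hr => Or.inl (sub_pos.2 (hr.2.trans_lt hst)).ne'

theorem integral_kernel_deriv {a s : ℝ} (has : a ≤ s) (hst : s < t) :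
    ∫ r in a..s, α * (t - r) ^ (-α - 1) = (t - s) ^ (-α) - (t - a) ^ (-α) := by
  refine intervalIntegral.integral_eq_sub_of_hasDerivAt (f := fun r => (t - r) ^ (-α))
    (fun r hr => hasDerivAt_kernel ?_) ((intervalIntegrable_kernel_deriv has hst).const_mul α)
  rw [uIcc_of_le has] at hr
  exact hr.2.trans_lt hst

theorem intervalIntegrable_smul_of_memLp_top {a b : ℝ} {k : ℝ → ℝ} {q : ℝ → E} (hab : a ≤ b)
    (hk : IntervalIntegrable k volume a b) (hq : MemLp q ∞ (volume.restrict (Ioo a b))) :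
    IntervalIntegrable (fun s => k s • q s) volume a b := by
  rw [intervalIntegrable_iff_integrableOn_Ioo_of_le hab] at hk ⊢
  exact Integrable.smul_of_top_left hk hq

theorem integral_kernel_sub_smul [CompleteSpace E] {a : ℝ} {q : ℝ → E} (hat : a ≤ t)
    (hα0 : 0 ≤ α) (hα1 : α < 1) (hq : MemLp q ∞ (volume.restrict (Ioo a t))) :
    ∫ s in a..t, ((t - s) ^ (-α) - (t - a) ^ (-α)) • q s =
      α • ∫ r in a..t, (t - r) ^ (-α - 1) • ∫ s in r..t, q s := by
  have hprim : ∀ s ∈ Ioo a t, ∫ r in a..s, α * (t - r) ^ (-α - 1)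
      = (t - s) ^ (-α) - (t - a) ^ (-α) := fun s hs => integral_kernel_deriv hs.1.le hs.2
  have hnorm : ∀ s ∈ Ioo a t, ∫ r in a..s, ‖α * (t - r) ^ (-α - 1)‖
      = (t - s) ^ (-α) - (t - a) ^ (-α) := fun s hs => by
    rw [← hprim s hs]
    refine intervalIntegral.integral_congr fun r hr => Real.norm_of_nonneg ?_
    rw [uIcc_of_le hs.1.le] at hr
    have : 0 ≤ t - r := by linarith [hr.2, hs.2]
    positivity
  have hfubini := integral_primitive_smul (κ := fun r => α * (t - r) ^ (-α - 1)) hat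
    (by fun_prop : Measurable _).aestronglyMeasurable hq.1
    (fun s hs => (intervalIntegrable_kernel_deriv hs.1.le hs.2).const_mul α)
    ((intervalIntegrable_smul_of_memLp_top hat
      ((intervalIntegrable_kernel hα1).sub
        (intervalIntegrable_const (c := (t - a) ^ (-α)))) hq).congr_uIoo
      (g := fun s => (∫ r in a..s, ‖α * (t - r) ^ (-α - 1)‖) • q s) fun s hs => by
        rw [uIoo_of_le hat] at hs
        simp only [hnorm s hs])
  simp only [mul_smul, intervalIntegral.integral_smul] at hfubini
  rw [← hfubini]
  refine intervalIntegral.integral_congr_Ioo_of_le hat fun s hs => ?_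
  simp only [← hprim s hs, intervalIntegral.integral_const_mul]

theorem MemW1Inf.integral_kernel_smul_deriv [CompleteSpace E] {a : ℝ} (h : MemW1Inf a t v)
    (hat : a ≤ t) (hα0 : 0 ≤ α) (hα1 : α < 1) :
    ∫ s in a..t, (t - s) ^ (-α) • deriv v s =
      (t - a) ^ (-α) • (v t - v a) + α • ∫ s in a..t, (t - s) ^ (-α - 1) • (v t - v s) := by
  calc ∫ s in a..t, (t - s) ^ (-α) • deriv v s
      = ∫ s in a..t, ((t - a) ^ (-α) • deriv v s
          + ((t - s) ^ (-α) - (t - a) ^ (-α)) • deriv v s) := by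
        simp only [← add_smul, add_sub_cancel]
    _ = (t - a) ^ (-α) • (∫ s in a..t, deriv v s)
          + α • ∫ r in a..t, (t - r) ^ (-α - 1) • ∫ s in r..t, deriv v s := by
        have hk : IntervalIntegrable (fun s => (t - s) ^ (-α) - (t - a) ^ (-α)) volume a t :=
          (intervalIntegrable_kernel hα1).sub intervalIntegrable_const
        rw [intervalIntegral.integral_add
          (intervalIntegrable_smul_of_memLp_top hat intervalIntegrable_const h.2.1)
          (intervalIntegrable_smul_of_memLp_top hat hk h.2.1),
          intervalIntegral.integral_smul, integral_kernel_sub_smul hat hα0 hα1 h.2.1]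
    _ = (t - a) ^ (-α) • (v t - v a) + α • ∫ s in a..t, (t - s) ^ (-α - 1) • (v t - v s) := by
        rw [← h.2.2 a (left_mem_Icc.2 hat) t (right_mem_Icc.2 hat)]
        congr 2
        refine intervalIntegral.integral_congr_Ioo_of_le hat fun r hr => ?_
        simp only [h.2.2 r (Ioo_subset_Icc_self hr) t (right_mem_Icc.2 hat)]

theorem MemW1Inf.exists_norm_sub_le {a b : ℝ} (h : MemW1Inf a b v) :
    ∃ C, ∀ s ∈ Icc a b, ∀ t ∈ Icc a b, ‖v t - v s‖ ≤ C * |t - s| := by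
  refine ⟨lpNorm (deriv v) ∞ (volume.restrict (Ioo a b)), fun s hs t ht => ?_⟩
  rw [h.2.2 s hs t ht]
  refine intervalIntegral.norm_integral_le_of_norm_le_const_ae ?_
  have hae : ∀ᵐ r ∂volume.restrict (Ioc a b),
      ‖deriv v r‖ ≤ lpNorm (deriv v) ∞ (volume.restrict (Ioo a b)) := by
    rw [← restrict_Ioo_eq_restrict_Ioc]
    exact ae_le_lpNorm_exponent_top h.2.1
  filter_upwards [ae_imp_of_ae_restrict hae] with r hr hrst
  exact hr ⟨(le_min hs.1 ht.1).trans_lt hrst.1, hrst.2.trans (max_le hs.2 ht.2)⟩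

theorem TimeRegular.mono (h : TimeRegular T v) (ht : t ≤ T) : TimeRegular t v :=
  fun ε s hε hεs hst => h ε s hε hεs (hst.trans ht)

theorem TimeRegular.continuousOn (h : TimeRegular T v) : ContinuousOn v (Ioc 0 T) := by
  intro t ht
  have htT : t / 2 < T := (half_lt_self ht.1).trans_le ht.2
  obtain ⟨C, hC⟩ := (h (t / 2) T (half_pos ht.1) htT le_rfl).2.exists_norm_sub_le
  have hmem : t ∈ Icc (t / 2) T := ⟨half_le_self ht.1.le, ht.2⟩
  have hLip : LipschitzOnWith C.toNNReal v (Icc (t / 2) T) :=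
    LipschitzOnWith.of_dist_le' fun s hs r hr => by
      rw [dist_eq_norm, Real.dist_eq]
      exact hC r hr s hs
  refine (hLip.continuousOn t hmem).mono_of_mem_nhdsWithin ?_
  filter_upwards [self_mem_nhdsWithin, mem_nhdsWithin_of_mem_nhds
    (Ioi_mem_nhds (half_lt_self ht.1))] with s hs hs'
  exact ⟨le_of_lt hs', hs.2⟩

theorem TimeRegular.exists_norm_le (h : TimeRegular T v) (hT : 0 < T) :
    ∃ M, ∀ t ∈ Ioc 0 T, ‖v t‖ ≤ M := by
  obtain ⟨hLp, -⟩ := h (T / 2) T (half_pos hT) (half_lt_self hT) le_rfl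
  set M := lpNorm v ∞ (volume.restrict (Ioo 0 T))
  have hae : (fun t => max ‖v t‖ M) =ᵐ[volume.restrict (Ioc 0 T)] fun _ => M := by
    rw [← restrict_Ioo_eq_restrict_Ioc]
    filter_upwards [ae_le_lpNorm_exponent_top hLp] with t ht
    exact max_eq_right ht
  exact ⟨M, fun t ht => max_eq_right_iff.1 (Measure.eqOn_Ioc_of_ae_eq volume hae
    (h.continuousOn.norm.sup continuousOn_const) continuousOn_const ht)⟩

theorem TimeRegular.exists_norm_sub_le (h : TimeRegular T v) (ht : t ∈ Ioc 0 T) :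
    ∃ C, ∀ s ∈ Ioo 0 t, ‖v t - v s‖ ≤ C * (t - s) := by
  obtain ⟨C, hC⟩ := (h (t / 2) t (half_pos ht.1) (half_lt_self ht.1) ht.2).2.exists_norm_sub_le
  obtain ⟨M, hM⟩ := h.exists_norm_le (ht.1.trans_le ht.2)
  refine ⟨max C (4 * M / t), fun s hs => ?_⟩
  have hts : 0 < t - s := sub_pos.2 hs.2
  rcases le_total (t / 2) s with hs2 | hs2
  · calc ‖v t - v s‖ ≤ C * |t - s| := hC s ⟨hs2, hs.2.le⟩ t ⟨half_le_self ht.1.le, le_rfl⟩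
      _ ≤ max C (4 * M / t) * (t - s) := by rw [abs_of_pos hts]; gcongr; exact le_max_left _ _
  · have hMt := hM t ht
    have hM0 : 0 ≤ M := (norm_nonneg _).trans hMt
    calc ‖v t - v s‖ ≤ M + M :=
          (norm_sub_le _ _).trans (add_le_add hMt (hM s ⟨hs.1, hs.2.le.trans ht.2⟩))
      _ = 4 * M / t * (t - t / 2) := by field_simp [ht.1.ne']; ring
      _ ≤ max C (4 * M / t) * (t - s) := by
          refine mul_le_mul (le_max_right _ _) (by linarith) (by linarith [ht.1]) ?_
          exact le_max_of_le_right (div_nonneg (by linarith) ht.1.le)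

theorem TimeRegular.aestronglyMeasurable (h : TimeRegular T v) (ht : t ≤ T) :
    AEStronglyMeasurable v (volume.restrict (Ioc 0 t)) :=
  (h.continuousOn.mono (Ioc_subset_Ioc_right ht)).aestronglyMeasurable measurableSet_Ioc

theorem TimeRegular.marchaudIntegrable (h : TimeRegular T v) (hα1 : α < 1) (ht : t ∈ Ioc 0 T) :
    MarchaudIntegrable α v t := by
  obtain ⟨C, hC⟩ := h.exists_norm_sub_le ht
  exact marchaudIntegrable_of_norm_sub_le hα1 ht.1.le (h.aestronglyMeasurable ht.2) hC

theorem tendsto_integral_nhdsGT_left {g : ℝ → E} (ht : 0 < t)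
    (hg : IntervalIntegrable g volume 0 t) :
    Tendsto (fun ε => ∫ s in ε..t, g s) (𝓝[>] 0) (𝓝 (∫ s in (0 : ℝ)..t, g s)) := by
  have hc := intervalIntegral.continuousOn_primitive_interval_left (a := (0 : ℝ)) (b := t)
    (μ := volume) (f := g) (by
      rw [uIcc_of_le ht.le, integrableOn_Icc_iff_integrableOn_Ioc]
      exact (intervalIntegrable_iff_integrableOn_Ioc_of_le ht.le).1 hg)
  refine (hc 0 left_mem_uIcc).mono_left ?_
  rw [uIcc_of_le ht.le, ← nhdsWithin_Ioc_eq_nhdsGT ht]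
  exact nhdsWithin_mono _ Ioc_subset_Icc_self

theorem TimeRegular.tendsto_kernel_sub_smul (h : TimeRegular T v) (ht : t ∈ Ioc 0 T) :
    Tendsto (fun ε => ((t - ε) ^ (-α) - t ^ (-α)) • (v t - v ε)) (𝓝[>] 0) (𝓝 0) := by
  obtain ⟨M, hM⟩ := h.exists_norm_le (ht.1.trans_le ht.2)
  have hk : Tendsto (fun ε : ℝ => (t - ε) ^ (-α) - t ^ (-α)) (𝓝[>] 0) (𝓝 0) := by
    have hc := ((hasDerivAt_kernel (α := α) ht.1).continuousAt.tendsto).sub_const (t ^ (-α))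
    rw [sub_zero, sub_self] at hc
    exact hc.mono_left nhdsWithin_le_nhds
  refine hk.zero_smul_isBoundedUnder_le (isBoundedUnder_of_eventually_le (a := M + M) ?_)
  filter_upwards [Ioc_mem_nhdsGT (ht.1.trans_le ht.2)] with ε hε
  exact (norm_sub_le _ _).trans (add_le_add (hM t ht) (hM ε hε))

theorem TimeRegular.caputoDeriv_eq [CompleteSpace E] (h : TimeRegular T v) (hα0 : 0 ≤ α)
    (hα1 : α < 1) (ht : t ∈ Ioc 0 T) :
    caputoDeriv α v t = marchaudDeriv α (fun s => v s - v 0) t := by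
  refine Tendsto.limUnder_eq (Tendsto.const_smul ?_ _)
  simp only [sub_sub_sub_cancel_right]
  have hlim := ((tendsto_const_nhds (x := t ^ (-α) • (v t - v 0))).add
    (h.tendsto_kernel_sub_smul (α := α) ht)).add
    ((tendsto_integral_nhdsGT_left ht.1 (h.marchaudIntegrable hα1 ht)).const_smul α)
  rw [add_zero] at hlim
  refine hlim.congr' ?_
  filter_upwards [Ioo_mem_nhdsGT ht.1] with ε hε
  rw [(h ε t hε.1 hε.2 ht.2).2.integral_kernel_smul_deriv hε.2.le hα0 hα1]
  module

end Caputo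

section Barrier

variable {α τ t lam : ℝ}

theorem E1_pos (hτ : 0 < τ) (t : ℝ) : 0 < E1 α τ t :=
  Real.rpow_pos_of_pos (hτ.trans_le (le_max_left τ t)) _

theorem E1_of_le (h : t ≤ τ) : E1 α τ t = τ ^ (α - 1) := by rw [E1, max_eq_left h]

theorem E1_of_ge (h : τ ≤ t) : E1 α τ t = t ^ (α - 1) := by rw [E1, max_eq_right h]

theorem E1_le_rpow (hα1 : α ≤ 1) (ht : 0 < t) (τ : ℝ) : E1 α τ t ≤ t ^ (α - 1) :=
  Real.rpow_le_rpow_of_nonpos ht (le_max_right _ _) (by linarith)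

theorem continuous_E1 (hτ : 0 < τ) : Continuous (E1 α τ) :=
  (continuous_const.max continuous_id).rpow_const fun s =>
    Or.inl (hτ.trans_le (le_max_left τ s)).ne'

theorem rpow_sub_rpow_le {s : ℝ} (hα1 : α ≤ 1) (hs : 0 < s) (hst : s ≤ t) :
    t ^ α - s ^ α ≤ (t - s) * s ^ (α - 1) := by
  have h : t ^ (α - 1) ≤ s ^ (α - 1) := Real.rpow_le_rpow_of_nonpos hs hst (by linarith)
  calc t ^ α - s ^ α = t * t ^ (α - 1) - s * s ^ (α - 1) := by
        rw [Real.rpow_sub_one (hs.trans_le hst).ne', Real.rpow_sub_one hs.ne',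
          mul_div_cancel₀ _ (hs.trans_le hst).ne', mul_div_cancel₀ _ hs.ne']
    _ ≤ t * s ^ (α - 1) - s * s ^ (α - 1) := by
        have := hs.trans_le hst
        gcongr
    _ = (t - s) * s ^ (α - 1) := by ring

theorem rpow_sub_one_sub_le {s : ℝ} (hα0 : 0 ≤ α) (hs : 0 < s) (hst : s ≤ t) :
    s ^ (α - 1) - t ^ (α - 1) ≤ s ^ (α - 1) * t⁻¹ * (t - s) := by
  have ht : 0 < t := hs.trans_le hst
  have h : s ^ α ≤ t ^ α := Real.rpow_le_rpow hs.le hst hα0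
  rw [Real.rpow_sub_one hs.ne', Real.rpow_sub_one ht.ne']
  calc s ^ α / s - t ^ α / t ≤ s ^ α / s - s ^ α / t := by gcongr
    _ = s ^ α / s * t⁻¹ * (t - s) := by field_simp

theorem abs_E1_sub_le {s : ℝ} (hα0 : 0 ≤ α) (hα1 : α ≤ 1) (hτ : 0 < τ) (hst : s ≤ t) :
    |E1 α τ t - E1 α τ s| ≤ τ ^ (α - 1) * τ⁻¹ * (t - s) := by
  have hm : 0 < max τ s := hτ.trans_le (le_max_left τ s)
  have hmM : max τ s ≤ max τ t := max_le_max_left τ hst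
  have hMm : max τ t - max τ s ≤ t - s := by
    rw [sub_le_iff_le_add]
    exact max_le (by linarith [le_max_left τ s]) (by linarith [le_max_right τ s])
  have hanti : E1 α τ t ≤ E1 α τ s := Real.rpow_le_rpow_of_nonpos hm hmM (by linarith)
  have hinv : (max τ t)⁻¹ ≤ τ⁻¹ := inv_anti₀ hτ (le_max_left τ t)
  have hpow : max τ s ^ (α - 1) ≤ τ ^ (α - 1) :=
    Real.rpow_le_rpow_of_nonpos hτ (le_max_left τ s) (by linarith)
  rw [abs_sub_comm, abs_of_nonneg (sub_nonneg.2 hanti)]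
  exact (rpow_sub_one_sub_le hα0 hm hmM).trans (by gcongr)

theorem marchaudIntegrable_E1 (hα0 : 0 ≤ α) (hα1 : α < 1) (hτ : 0 < τ) (ht : 0 ≤ t) :
    MarchaudIntegrable α (E1 α τ) t :=
  marchaudIntegrable_of_norm_sub_le hα1 ht (continuous_E1 hτ).aestronglyMeasurable
    fun _ hs => abs_E1_sub_le hα0 hα1.le hτ hs.2.le

theorem hasDerivAt_kernel_mul_rpow_sub {s : ℝ} (hs : 0 < s) (hst : s < t) :
    HasDerivAt (fun s => t⁻¹ * ((t - s) ^ (-α) * (t ^ α - s ^ α)))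
      (α * ((t - s) ^ (-α - 1) * (t ^ (α - 1) - s ^ (α - 1)))) s := by
  have hts : 0 < t - s := sub_pos.2 hst
  have ht : 0 < t := hs.trans hst
  have hpow := ((Real.hasDerivAt_rpow_const (p := α) (Or.inl hs.ne')).const_sub (t ^ α))
  refine (((hasDerivAt_kernel hst).mul hpow).const_mul t⁻¹).congr_deriv ?_
  rw [Real.rpow_sub_one hts.ne', Real.rpow_sub_one ht.ne', Real.rpow_sub_one hs.ne']
  field_simp
  ring

theorem tendsto_kernel_mul_rpow_sub (hα1 : α < 1) (hα0 : 0 ≤ α) (ht : 0 < t) :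
    Tendsto (fun s => (t - s) ^ (-α) * (t ^ α - s ^ α)) (𝓝[<] t) (𝓝 0) := by
  have hbound : Tendsto (fun s => (t - s) ^ (1 - α) * s ^ (α - 1)) (𝓝[<] t) (𝓝 0) := by
    have hc : ContinuousAt (fun s => (t - s) ^ (1 - α) * s ^ (α - 1)) t :=
      ((continuousAt_const.sub continuousAt_id).rpow_const (Or.inr (by linarith))).mul
        (continuousAt_id.rpow_const (Or.inl ht.ne'))
    have h := hc.tendsto
    rw [sub_self, Real.zero_rpow (by linarith), zero_mul] at h
    exact h.mono_left nhdsWithin_le_nhds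
  refine squeeze_zero' ?_ ?_ hbound <;> filter_upwards [Ioo_mem_nhdsLT ht] with s hs
  · have hts : 0 ≤ t - s := sub_nonneg.2 hs.2.le
    have hpow := sub_nonneg.2 (Real.rpow_le_rpow hs.1.le hs.2.le hα0)
    positivity
  · have hts : 0 < t - s := sub_pos.2 hs.2
    calc (t - s) ^ (-α) * (t ^ α - s ^ α) ≤ (t - s) ^ (-α) * ((t - s) * s ^ (α - 1)) := by
          gcongr; exact rpow_sub_rpow_le hα1.le hs.1 hs.2.le
      _ = (t - s) ^ (1 - α) * s ^ (α - 1) := by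
          rw [← mul_assoc, sub_eq_neg_add 1 α, Real.rpow_add_one hts.ne']

theorem integral_kernel_deriv_mul_rpow_sub (hα0 : 0 ≤ α) (hα1 : α < 1) (hτ : 0 < τ) (hτt : τ < t)
    (hint : IntervalIntegrable
      (fun s => (t - s) ^ (-α - 1) * (t ^ (α - 1) - s ^ (α - 1))) volume τ t) :
    α * ∫ s in τ..t, (t - s) ^ (-α - 1) * (t ^ (α - 1) - s ^ (α - 1)) =
      -(t⁻¹ * ((t - τ) ^ (-α) * (t ^ α - τ ^ α))) := by
  have hend := (tendsto_kernel_mul_rpow_sub hα1 hα0 (hτ.trans hτt)).const_mul t⁻¹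
  have h := intervalIntegral.integral_eq_sub_of_hasDerivAt_of_tendsto hτt
    (fun s hs => hasDerivAt_kernel_mul_rpow_sub (α := α) (hτ.trans hs.1) hs.2)
    (hint.const_mul α)
    ((hasDerivAt_kernel_mul_rpow_sub hτ hτt).continuousAt.tendsto.mono_left nhdsWithin_le_nhds)
    hend
  rw [intervalIntegral.integral_const_mul] at h
  rw [h]
  ring

theorem inv_mul_div_rpow (hτ : 0 < τ) (ht : 0 < t) :
    t⁻¹ * (τ / t) ^ (-(1 - α)) = t ^ (-α) * τ ^ (α - 1) := by
  rw [Real.div_rpow hτ.le ht.le, neg_sub, Real.rpow_sub_one ht.ne', Real.rpow_neg ht.le]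
  field_simp

theorem inv_mul_rho_of_le (hα1 : α < 1) (ht : 0 < t) (h : t ≤ τ) :
    t⁻¹ * rho α (τ / t) = t ^ (-α) * τ ^ (α - 1) := by
  rw [rho, max_eq_left (sub_nonpos.2 ((one_le_div ht).2 h)), Real.zero_rpow (by linarith),
    sub_zero, mul_one, inv_mul_div_rpow (ht.trans_le h) ht]

theorem inv_mul_rho_of_lt (hτ : 0 < τ) (h : τ < t) :
    t⁻¹ * rho α (τ / t) = t ^ (-α) * τ ^ (α - 1) - t⁻¹ * τ ^ (α - 1) * (t - τ) ^ (1 - α) := by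
  have ht : 0 < t := hτ.trans h
  rw [rho, max_eq_right (sub_nonneg.2 ((div_le_one ht).2 h.le)), ← mul_assoc,
    inv_mul_div_rpow hτ ht, mul_sub, mul_one]
  have : 1 - τ / t = (t - τ) / t := by field_simp
  rw [this, Real.div_rpow (sub_nonneg.2 h.le) ht.le, sub_eq_neg_add 1 α,
    Real.rpow_add_one ht.ne']
  have := (Real.rpow_pos_of_pos ht (-α)).ne'
  field_simp

theorem marchaudDeriv_E1_of_le (hα1 : α < 1) (ht : 0 < t) (h : t ≤ τ) :
    marchaudDeriv α (E1 α τ) t = (Real.Gamma (1 - α))⁻¹ * (t⁻¹ * rho α (τ / t)) := by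
  have hzero : ∫ s in (0 : ℝ)..t, (t - s) ^ (-α - 1) * (E1 α τ t - E1 α τ s) = 0 := by
    rw [intervalIntegral.integral_congr_Ioo_of_le (g := fun _ => (0 : ℝ)) ht.le,
      intervalIntegral.integral_zero]
    intro s hs
    simp only [E1_of_le h, E1_of_le (hs.2.le.trans h), sub_self, mul_zero]
  simp only [marchaudDeriv, smul_eq_mul]
  rw [hzero, E1_of_le h, inv_mul_rho_of_le hα1 ht h, mul_zero, add_zero]

theorem marchaudDeriv_E1_of_lt (hα0 : 0 ≤ α) (hα1 : α < 1) (hτ : 0 < τ) (h : τ < t) :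
    marchaudDeriv α (E1 α τ) t = (Real.Gamma (1 - α))⁻¹ * (t⁻¹ * rho α (τ / t)) := by
  have ht : 0 < t := hτ.trans h
  have hτm : τ ∈ uIcc 0 t := by rw [uIcc_of_le ht.le]; exact ⟨hτ.le, h.le⟩
  have hint := marchaudIntegrable_E1 (t := t) hα0 hα1 hτ ht.le
  simp only [MarchaudIntegrable, smul_eq_mul] at hint
  have hint₁ := hint.mono_set (uIcc_subset_uIcc_left hτm)
  have hint₂ := hint.mono_set (uIcc_subset_uIcc_right hτm)
  have heq₂ : EqOn (fun s => (t - s) ^ (-α - 1) * (E1 α τ t - E1 α τ s))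
      (fun s => (t - s) ^ (-α - 1) * (t ^ (α - 1) - s ^ (α - 1))) (Ioo τ t) := fun s hs => by
    simp only [E1_of_ge h.le, E1_of_ge hs.1.le]
  have h₁ : α * ∫ s in (0 : ℝ)..τ, (t - s) ^ (-α - 1) * (E1 α τ t - E1 α τ s)
      = ((t - τ) ^ (-α) - t ^ (-α)) * (t ^ (α - 1) - τ ^ (α - 1)) := by
    rw [intervalIntegral.integral_congr_Ioo_of_le hτ.le
      (g := fun s => (t - s) ^ (-α - 1) * (t ^ (α - 1) - τ ^ (α - 1))) fun s hs => by
        simp only [E1_of_ge h.le, E1_of_le hs.2.le],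
      intervalIntegral.integral_mul_const, ← mul_assoc, ← intervalIntegral.integral_const_mul,
      integral_kernel_deriv hτ.le h, sub_zero]
  have h₂ := integral_kernel_deriv_mul_rpow_sub hα0 hα1 hτ h
    (hint₂.congr_uIoo (by rwa [uIoo_of_le h.le]))
  rw [← intervalIntegral.integral_congr_Ioo_of_le h.le heq₂] at h₂
  simp only [marchaudDeriv, smul_eq_mul]
  congr 1
  rw [← intervalIntegral.integral_add_adjacent_intervals hint₁ hint₂, mul_add, h₁, h₂,
    inv_mul_rho_of_lt hτ h, E1_of_ge h.le, sub_eq_neg_add 1 α,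
    Real.rpow_add_one (sub_pos.2 h).ne', Real.rpow_sub_one ht.ne', Real.rpow_sub_one hτ.ne']
  field_simp
  ring

theorem marchaudDeriv_E1 (hα0 : 0 ≤ α) (hα1 : α < 1) (hτ : 0 < τ) (ht : 0 < t) :
    marchaudDeriv α (E1 α τ) t = (Real.Gamma (1 - α))⁻¹ * (t⁻¹ * rho α (τ / t)) :=
  (le_or_gt t τ).elim (marchaudDeriv_E1_of_le hα1 ht) (marchaudDeriv_E1_of_lt hα0 hα1 hτ)

theorem rpow_mul_min_le_rho {s : ℝ} (hα0 : 0 ≤ α) (hα1 : α < 1) (hs : 0 < s) :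
    s ^ (-(1 - α)) * min ((1 - α) * s) 1 ≤ rho α s := by
  refine mul_le_mul_of_nonneg_left ?_ (Real.rpow_nonneg hs.le _)
  rcases le_total s 1 with h | h
  · rw [max_eq_right (sub_nonneg.2 h)]
    have hbernoulli : (1 - s) ^ (1 - α) ≤ 1 - (1 - α) * s := by
      simpa [sub_eq_add_neg] using rpow_one_add_le_one_add_mul_self (s := -s) (by linarith)
        (p := 1 - α) (by linarith) (by linarith)
    linarith [min_le_left ((1 - α) * s) 1]
  · rw [max_eq_left (sub_nonpos.2 h), Real.zero_rpow (by linarith), sub_zero]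
    exact min_le_right _ _

theorem rho_pos {s : ℝ} (hα0 : 0 ≤ α) (hα1 : α < 1) (hs : 0 < s) : 0 < rho α s :=
  (mul_pos (Real.rpow_pos_of_pos hs _) (lt_min (mul_pos (by linarith) hs) one_pos)).trans_le
    (rpow_mul_min_le_rho hα0 hα1 hs)

theorem R1_eq (hα0 : 0 ≤ α) (hα1 : α < 1) (hτ : 0 < τ) (ht : 0 < t) :
    R1 α lam τ t = marchaudDeriv α (E1 α τ) t + lam * E1 α τ t := by
  rw [marchaudDeriv_E1 hα0 hα1 hτ ht, R1, mul_assoc (Real.Gamma (1 - α))⁻¹]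

theorem marchaudDeriv_E1_pos (hα0 : 0 ≤ α) (hα1 : α < 1) (hτ : 0 < τ) (ht : 0 < t) :
    0 < marchaudDeriv α (E1 α τ) t := by
  have : 0 < Real.Gamma (1 - α) := Real.Gamma_pos_of_pos (by linarith)
  have hρ := rho_pos hα0 hα1 (div_pos hτ ht)
  rw [marchaudDeriv_E1 hα0 hα1 hτ ht]
  positivity

theorem R1_pos (hα0 : 0 ≤ α) (hα1 : α < 1) (hlam : 0 ≤ lam) (hτ : 0 < τ) (ht : 0 < t) :
    0 < R1 α lam τ t := by
  rw [R1_eq hα0 hα1 hτ ht]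
  exact add_pos_of_pos_of_nonneg (marchaudDeriv_E1_pos hα0 hα1 hτ ht)
    (mul_nonneg hlam (E1_pos hτ t).le)

theorem R1_eq_of_le (hα1 : α < 1) (ht : 0 < t) (h : t ≤ τ) :
    R1 α lam τ t = τ ^ (α - 1) * R0 α lam t := by
  rw [R1, R0, E1, max_eq_left h, mul_assoc, inv_mul_rho_of_le hα1 ht h]
  ring

end Barrier

section Estimate

variable {α lam T t τ : ℝ}

theorem le_of_marchaudDeriv_add_le {w ψ : ℝ → ℝ} {M : ℝ} (hα0 : 0 ≤ α) (hα1 : α < 1)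
    (hlam : 0 ≤ lam) (hwc : ContinuousOn w (Ioc 0 T)) (hψc : ContinuousOn ψ (Ioc 0 T))
    (hw : ∀ t ∈ Ioc 0 T, MarchaudIntegrable α w t) (hψ : ∀ t ∈ Ioc 0 T, MarchaudIntegrable α ψ t)
    (hM : ∀ t ∈ Ioc 0 T, w t ≤ M) (hψ0 : ∀ t ∈ Ioc 0 T, 0 ≤ ψ t)
    (hD : ∀ t ∈ Ioc 0 T, 0 < w t →
      marchaudDeriv α w t + lam * w t ≤ marchaudDeriv α ψ t + lam * ψ t) :
    ∀ t ∈ Ioc 0 T, w t ≤ ψ t := by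
  -- Near `0` the function `w` is merely bounded: the perturbation `η E₁(δ, ·)`, whose derivative is
  -- positive, dominates it on `(0, δ]`.
  have hpert : ∀ η > 0, ∀ t ∈ Ioc 0 T, w t ≤ ψ t + η * t ^ (α - 1) := by
    intro η hη t ht
    obtain ⟨δ, hδM, hδ⟩ := (((tendsto_rpow_neg_nhdsGT_zero (by linarith : α - 1 < 0)
      |>.const_mul_atTop hη).eventually_ge_atTop M).and self_mem_nhdsWithin).exists
    have hE : ∀ s ∈ Ioc 0 T, MarchaudIntegrable α (fun s => η * E1 α δ s) s := fun s hs =>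
      (marchaudIntegrable_E1 hα0 hα1 hδ hs.1.le).const_mul η
    refine (le_of_marchaudDeriv_le (g := fun s => ψ s + η * E1 α δ s) hα0 hα1 hδ hwc
      (hψc.add (continuous_const.mul (continuous_E1 hδ)).continuousOn) hw
      (fun s hs => (hψ s hs).add (hE s hs)) (fun s hs hsδ => ?_) (fun s hs hgt => ?_) t ht).trans ?_
    · rw [E1_of_le hsδ]
      linarith [hM s hs, hψ0 s hs]
    · have hηE := mul_pos hη (E1_pos (α := α) hδ s)
      have hDE := mul_pos hη (marchaudDeriv_E1_pos hα0 hα1 hδ hs.1)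
      rw [marchaudDeriv_add (hψ s hs) (hE s hs), marchaudDeriv_const_mul]
      have hψw := mul_le_mul_of_nonneg_left (show ψ s ≤ w s by linarith) hlam
      linarith [hD s hs (by linarith [hψ0 s hs])]
    · gcongr
      exact E1_le_rpow hα1.le ht.1 δ
  intro t ht
  have htα : 0 < t ^ (α - 1) := Real.rpow_pos_of_pos ht.1 _
  refine le_of_forall_pos_le_add fun ε hε => ?_
  simpa only [div_mul_cancel₀ ε htα.ne'] using hpert (ε / t ^ (α - 1)) (div_pos hε htα) t ht

variable {H : Type*} [NormedAddCommGroup H] [InnerProductSpace ℝ H] [CompleteSpace H]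

theorem norm_le_of_inner_marchaudDeriv_le {e : ℝ → H} {ψ : ℝ → ℝ} {M : ℝ} (hα0 : 0 ≤ α)
    (hα1 : α < 1) (hlam : 0 ≤ lam) (hec : ContinuousOn e (Ioc 0 T))
    (hψc : ContinuousOn ψ (Ioc 0 T)) (he : ∀ t ∈ Ioc 0 T, MarchaudIntegrable α e t)
    (hψ : ∀ t ∈ Ioc 0 T, MarchaudIntegrable α ψ t) (hM : ∀ t ∈ Ioc 0 T, ‖e t‖ ≤ M)
    (hψ0 : ∀ t ∈ Ioc 0 T, 0 ≤ ψ t)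
    (hD : ∀ t ∈ Ioc 0 T, inner ℝ (e t) (marchaudDeriv α e t) + lam * ‖e t‖ ^ 2 ≤
      (marchaudDeriv α ψ t + lam * ψ t) * ‖e t‖) :
    ∀ t ∈ Ioc 0 T, ‖e t‖ ≤ ψ t := by
  have hn : ∀ t ∈ Ioc 0 T, MarchaudIntegrable α (fun s => ‖e s‖) t := fun t ht =>
    (he t ht).norm ht.1.le
      ((hec.mono (Ioc_subset_Ioc_right ht.2)).aestronglyMeasurable measurableSet_Ioc)
  refine le_of_marchaudDeriv_add_le hα0 hα1 hlam hec.norm hψc hn hψ hM hψ0 fun t ht hpos => ?_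
  have henergy := norm_mul_marchaudDeriv_norm_le hα0 hα1 ht.1.le (he t ht) (hn t ht)
  refine le_of_mul_le_mul_right ?_ hpos
  linarith [hD t ht]

theorem norm_sub_le_mul_E1 {u uh : ℝ → H} {r : ℝ → ℝ} {K : ℝ} (hα0 : 0 ≤ α) (hα1 : α < 1)
    (hlam : 0 ≤ lam) (hτ : 0 < τ) (hK : 0 ≤ K) (hu : TimeRegular T u) (huh : TimeRegular T uh)
    (h0 : uh 0 = u 0)
    (henergy : ∀ t ∈ Ioc 0 T,
      inner ℝ (uh t - u t) (caputoDeriv α uh t - caputoDeriv α u t) + lam * ‖uh t - u t‖ ^ 2 ≤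
        r t * ‖uh t - u t‖)
    (hr : ∀ t ∈ Ioc 0 T, r t ≤ K * R1 α lam τ t) (ht : t ∈ Ioc 0 T) :
    ‖uh t - u t‖ ≤ K * E1 α τ t := by
  obtain ⟨M, hM⟩ := hu.exists_norm_le (ht.1.trans_le ht.2)
  obtain ⟨N, hN⟩ := huh.exists_norm_le (ht.1.trans_le ht.2)
  have hDe : ∀ t ∈ Ioc 0 T, marchaudDeriv α (fun s => uh s - u s) t
      = caputoDeriv α uh t - caputoDeriv α u t := fun t ht => by
    rw [huh.caputoDeriv_eq hα0 hα1 ht, hu.caputoDeriv_eq hα0 hα1 ht, ← marchaudDeriv_sub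
      ((huh.marchaudIntegrable hα1 ht).sub (marchaudIntegrable_const _))
      ((hu.marchaudIntegrable hα1 ht).sub (marchaudIntegrable_const _))]
    simp only [h0, sub_sub_sub_cancel_right]
  refine norm_le_of_inner_marchaudDeriv_le (e := fun t => uh t - u t)
    (ψ := fun t => K * E1 α τ t) hα0 hα1 hlam (huh.continuousOn.sub hu.continuousOn)
    (continuous_const.mul (continuous_E1 hτ)).continuousOn
    (fun t ht => (huh.marchaudIntegrable hα1 ht).sub (hu.marchaudIntegrable hα1 ht))
    (fun t ht => (marchaudIntegrable_E1 hα0 hα1 hτ ht.1.le).const_mul K)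
    (fun t ht => (norm_sub_le _ _).trans (add_le_add (hN t ht) (hM t ht)))
    (fun t _ => mul_nonneg hK (E1_pos hτ t).le) (fun t ht => ?_) t ht
  rw [hDe t ht, marchaudDeriv_const_mul, mul_left_comm lam, ← mul_add, ← R1_eq hα0 hα1 hτ ht.1]
  exact (henergy t ht).trans (by gcongr; exact hr t ht)

theorem ofReal_norm_sub_le_iSup {u uh : ℝ → H} {r : ℝ → ℝ} (hα0 : 0 ≤ α) (hα1 : α < 1)
    (hlam : 0 ≤ lam) (hτ : 0 < τ) (hu : TimeRegular T u) (huh : TimeRegular T uh)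
    (h0 : uh 0 = u 0)
    (henergy : ∀ t ∈ Ioc 0 T,
      inner ℝ (uh t - u t) (caputoDeriv α uh t - caputoDeriv α u t) + lam * ‖uh t - u t‖ ^ 2 ≤
        r t * ‖uh t - u t‖)
    (ht : t ∈ Ioc 0 T) :
    ENNReal.ofReal ‖uh t - u t‖ ≤
      ENNReal.ofReal (E1 α τ t) * ⨆ s ∈ Ioc 0 t, ENNReal.ofReal (r s / R1 α lam τ s) := by
  have hE : 0 < E1 α τ t := E1_pos hτ t
  set S := ⨆ s ∈ Ioc 0 t, ENNReal.ofReal (r s / R1 α lam τ s) with hS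
  rcases eq_or_ne S ∞ with htop | hfin
  · rw [htop, ENNReal.mul_top (ENNReal.ofReal_pos.2 hE).ne']
    exact le_top
  · rw [← ENNReal.ofReal_toReal hfin, ← ENNReal.ofReal_mul hE.le, mul_comm]
    refine ENNReal.ofReal_le_ofReal (norm_sub_le_mul_E1 hα0 hα1 hlam hτ ENNReal.toReal_nonneg
      (hu.mono ht.2) (huh.mono ht.2) h0 (fun s hs => henergy s ⟨hs.1, hs.2.trans ht.2⟩)
      (fun s hs => ?_) ⟨ht.1, le_rfl⟩)
    rw [← div_le_iff₀ (R1_pos hα0 hα1 hlam hτ hs.1), ← ENNReal.ofReal_le_iff_le_toReal hfin, hS]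
    exact le_iSup₂ (f := fun s (_ : s ∈ Ioc 0 t) => ENNReal.ofReal (r s / R1 α lam τ s)) s hs

theorem ofReal_rpow_mul_iSup_div_R1 {r : ℝ → ℝ} (hα1 : α < 1) (hτ : 0 < τ) (h : t ≤ τ) :
    ENNReal.ofReal (τ ^ (α - 1)) * ⨆ s ∈ Ioc 0 t, ENNReal.ofReal (r s / R1 α lam τ s) =
      ⨆ s ∈ Ioc 0 t, ENNReal.ofReal (r s / R0 α lam s) := by
  have hτα : 0 < τ ^ (α - 1) := Real.rpow_pos_of_pos hτ _
  simp only [ENNReal.mul_iSup]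
  refine iSup_congr fun s => iSup_congr fun hs => ?_
  rw [← ENNReal.ofReal_mul hτα.le, R1_eq_of_le hα1 hs.1 (hs.2.trans h), ← mul_div_assoc,
    mul_div_mul_left _ _ hτα.ne']

end Estimate

end FracParabolic

open FracParabolic in
theorem corollary2_general {H : Type*} [NormedAddCommGroup H] [InnerProductSpace ℝ H]
    [CompleteSpace H] {V : Submodule ℝ H} {α T lam : ℝ} (hα0 : 0 ≤ α) (hα1 : α < 1)
    (hlam : 0 ≤ lam) (L : ℝ → V → Module.Dual ℝ V)
    (hL : ∀ t ∈ Ioc 0 T, ∀ v w : V, lam * ‖(v - w : H)‖ ^ 2 ≤ L t v (v - w) - L t w (v - w))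
    (f : ℝ → Module.Dual ℝ V) (u uh Rh : ℝ → H) (hu : TimeRegular T u) (huh : TimeRegular T uh)
    (huV : ∀ t ∈ Ioc 0 T, u t ∈ V) (huhV : ∀ t ∈ Ioc 0 T, uh t ∈ V) (h0 : uh 0 = u 0)
    (hsol : ∀ (t : ℝ) (ht : t ∈ Ioc 0 T) (w : V),
      inner ℝ (caputoDeriv α u t) (w : H) + L t ⟨u t, huV t ht⟩ w = f t w)
    (hRh : ∀ (t : ℝ) (ht : t ∈ Ioc 0 T) (w : V),
      inner ℝ (Rh t) (w : H) =
        inner ℝ (caputoDeriv α uh t) (w : H) + L t ⟨uh t, huhV t ht⟩ w - f t w) :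
    (∀ t ∈ Ioc 0 T,
      ENNReal.ofReal ‖uh t - u t‖ ≤ ⨆ s ∈ Ioc 0 t, ENNReal.ofReal (‖Rh s‖ / R0 α lam s)) ∧
    (∀ τ : ℝ, 0 < τ → ∀ t ∈ Ioc 0 T,
      ENNReal.ofReal ‖uh t - u t‖ ≤ ENNReal.ofReal (t ^ (α - 1)) *
        ⨆ s ∈ Ioc 0 t, ENNReal.ofReal (‖Rh s‖ / R1 α lam τ s)) ∧
    (∀ τ : ℝ, 0 < τ → ∀ t ∈ Ioc 0 T,
      ENNReal.ofReal ‖uh t - u t‖ ≤ ENNReal.ofReal (E1 α τ t) *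
        ⨆ s ∈ Ioc 0 t, ENNReal.ofReal (‖Rh s‖ / R1 α lam τ s)) ∧
    (∀ s : ℝ, 0 < s → s ^ (-(1 - α)) * min ((1 - α) * s) 1 ≤ rho α s) := by
  have henergy : ∀ t ∈ Ioc 0 T,
      inner ℝ (uh t - u t) (caputoDeriv α uh t - caputoDeriv α u t) + lam * ‖uh t - u t‖ ^ 2 ≤
        ‖Rh t‖ * ‖uh t - u t‖ := by
    intro t ht
    let w : V := ⟨uh t, huhV t ht⟩ - ⟨u t, huV t ht⟩
    have hcoer : lam * ‖uh t - u t‖ ^ 2 ≤ L t ⟨uh t, huhV t ht⟩ w - L t ⟨u t, huV t ht⟩ w :=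
      hL t ht ⟨uh t, huhV t ht⟩ ⟨u t, huV t ht⟩
    have hcs : inner ℝ (Rh t) (w : H) ≤ ‖Rh t‖ * ‖uh t - u t‖ := real_inner_le_norm _ _
    have hw : inner ℝ (uh t - u t) (caputoDeriv α uh t - caputoDeriv α u t)
        = inner ℝ (caputoDeriv α uh t) (w : H) - inner ℝ (caputoDeriv α u t) (w : H) := by
      rw [real_inner_comm, inner_sub_left]; rfl
    linarith [hsol t ht w, hRh t ht w]
  have hbound := fun (τ : ℝ) (hτ : 0 < τ) (t : ℝ) (ht : t ∈ Ioc 0 T) =>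
    ofReal_norm_sub_le_iSup hα0 hα1 hlam hτ hu huh h0 henergy ht
  refine ⟨fun t ht => ?_, fun τ hτ t ht => (hbound τ hτ t ht).trans ?_, hbound,
    fun s hs => rpow_mul_min_le_rho hα0 hα1 hs⟩
  · rw [← ofReal_rpow_mul_iSup_div_R1 hα1 ht.1 le_rfl, ← E1_of_le le_rfl]
    exact hbound t ht.1 t ht
  · gcongr
    exact E1_le_rpow hα1.le ht.1 τ

/-- Here `L v w = ⟨𝓛 v, w⟩` and `f t w = ⟨f(·,t), w⟩` for `v, w ∈ H¹₀(Ω)` (the values of `𝓛` and `f`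
are functionals on `H¹₀(Ω)`; elements of `H⁻¹(Ω)` and of `L₂(Ω)` are such). The fractional parabolic
equation and the definition of the residual are identities of functionals on `H¹₀(Ω)`, at each
`0 < t ≤ T`. The suprema are taken in `[0, ∞]`. -/
theorem corollary2 {d : ℕ} {Ω : Set (EuclideanSpace ℝ (Fin d))} (hΩ : IsOpen Ω)
    {α T lam : ℝ} (hα0 : 0 < α) (hα1 : α < 1) (hT : 0 < T) (hlam : 0 ≤ lam)
    (L : FracParabolic.H10 Ω →ₗ[ℝ] Module.Dual ℝ (FracParabolic.H10 Ω))
    (hL : ∀ v : FracParabolic.H10 Ω, lam * ‖(v : FracParabolic.L2 Ω)‖ ^ 2 ≤ L v v)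
    (f : ℝ → Module.Dual ℝ (FracParabolic.H10 Ω))
    (u₀ : FracParabolic.L2 Ω) (u uh Rh : ℝ → FracParabolic.L2 Ω)
    (hu : FracParabolic.TimeRegular T u) (huh : FracParabolic.TimeRegular T uh)
    (huV : ∀ t ∈ Ioc 0 T, u t ∈ FracParabolic.H10 Ω)
    (huhV : ∀ t ∈ Ioc 0 T, uh t ∈ FracParabolic.H10 Ω)
    (hu0 : u 0 = u₀) (huh0 : uh 0 = u₀)
    (hsol : ∀ (t : ℝ) (ht : t ∈ Ioc 0 T) (w : FracParabolic.H10 Ω),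
      inner ℝ (FracParabolic.caputoDeriv α u t) (w : FracParabolic.L2 Ω)
        + L ⟨u t, huV t ht⟩ w = f t w)
    (hRh : ∀ (t : ℝ) (ht : t ∈ Ioc 0 T) (w : FracParabolic.H10 Ω),
      inner ℝ (Rh t) (w : FracParabolic.L2 Ω) =
        inner ℝ (FracParabolic.caputoDeriv α uh t) (w : FracParabolic.L2 Ω)
          + L ⟨uh t, huhV t ht⟩ w - f t w) :
    (∀ t ∈ Ioc 0 T,
      ENNReal.ofReal ‖uh t - u t‖ ≤
        ⨆ s ∈ Ioc 0 t, ENNReal.ofReal (‖Rh s‖ / FracParabolic.R0 α lam s)) ∧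
    (∀ τ : ℝ, 0 < τ → ∀ t ∈ Ioc 0 T,
      ENNReal.ofReal ‖uh t - u t‖ ≤
        ENNReal.ofReal (t ^ (α - 1)) *
          ⨆ s ∈ Ioc 0 t, ENNReal.ofReal (‖Rh s‖ / FracParabolic.R1 α lam τ s)) ∧
    (∀ τ : ℝ, 0 < τ → ∀ t ∈ Ioc 0 T,
      ENNReal.ofReal ‖uh t - u t‖ ≤
        ENNReal.ofReal (FracParabolic.E1 α τ t) *
          ⨆ s ∈ Ioc 0 t, ENNReal.ofReal (‖Rh s‖ / FracParabolic.R1 α lam τ s)) ∧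
    (∀ s : ℝ, 0 < s →
      s ^ (-(1 - α)) * min ((1 - α) * s) 1 ≤ FracParabolic.rho α s) := by
  refine corollary2_general hα0.le hα1 hlam (fun _ => L) (fun _ _ v w => ?_) f u uh Rh hu huh
    huV huhV (huh0.trans hu0.symm) hsol hRh
  rw [← LinearMap.sub_apply, ← map_sub]
  exact hL (v - w)
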